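/- Let $T>0$, $\gamma\in\mathbb Z$, $K,p\in\mathbb N$, and $\Omega=[0,2\pi/T)$. For $x\in L_2(\mathbb R)$ write $X(\omega)=\int x(t)e^{-j\omega t}\,dt$ for its Fourier transform, and for $a\in\ell_2(\mathbb Z)$ write $A(e^{j\omega T})=\sum_{n}a[n]e^{-j\omega nT}$ (series in $L_2(\Omega)$) for its discrete-time Fourier transform (DTFT). Let $g\in L_2(\mathbb R)$, let $\tau=(t_1,\dots,t_K)$ be distinct delays in $[0,T)$, let $a_1,\dots,a_K\in\ell_2(\mathbb Z)$, and let $$x(t)=\sum_{k=1}^K\sum_{n\in\mathbb Z}a_k[n]\,g(t-t_k-nT)\in L_2(\mathbb R),$$ the series being the limit in $L_2(\mathbb R)$ of its symmetric partial sums ($|n|\le N$, $N\to\infty$). Let $s_1,\dots,s_p\in L_2(\mathbb R)$ have Fourier transforms $S_\ell$ that vanish a.e. outside $\mathcal F=[\frac{2\pi}{T}\gamma,\frac{2\pi}{T}(p+\gamma)]$, and let $c_\ell[n]=\int x(t)\,s_\ell^*(t-nT)\,dt$. For $1\le \ell,m\le p$ and $1\le k\le K$ put $$\mathbf S_{\ell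 m}(e^{j\omega T})=\tfrac1T S_\ell^*\bigl(\omega+\tfrac{2\pi}{T}(m-1+\gamma)\bigr),\qquad \mathbf W_{\ell m}(e^{j\omega T})=\mathbf S_{\ell m}(e^{j\omega T})\,G\bigl(\omega+\tfrac{2\pi}{T}(m-1+\gamma)\bigr),$$ $$\mathbf N_{mk}(\tau)=e^{-j\frac{2\pi}{T}(m-1+\gamma)t_k},\qquad \mathbf D(e^{j\omega T},\tau)=\mathrm{diag}\bigl(e^{-j\omega t_1},\dots,e^{-j\omega t_K}\bigr).$$ Call a matrix function on $\Omega$ stably invertible if its singular values lie between two positive constants for a.e. $\omega\in\Omega$. Assume that $0<\alpha\le|G(\omega)|\le\beta<\infty$ for some constants $\alpha,\beta$ and a.e. $\omega\in\mathcal F$, and that $\mathbf S$ is stably invertible. Then: 1. every $c_\ell$ is in $\ell_2(\mathbb Z)$, and $\mathbf W$ is stably invertible; 2. with $\mathbf c(e^{j\omega T})$ and $\mathbf a(e^{j\omega T})$ the vectors of the DTFTs of the $c_\ell$ and of the $a_k$, $\mathbf d=\mathbf W^{-1}\mathbf c$ and $\mathbf b=\mathbf D\mathbf a$, one has $\mathbf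 d(e^{j\omega T})=\mathbf N(\tau)\,\mathbf b(e^{j\omega T})$ for a.e. $\omega\in\Omega$; 3. if $p\ge 2K$ and no $a_k$ is the zero sequence, then these equations determine $\tau$ and $\mathbf b$ up to the numbering of the paths: if $\tau'$ consists of $K$ distinct delays in $[0,T)$ and $\mathbf d=\mathbf N(\tau')\mathbf b'$ a.e. on $\Omega$ for a function $\mathbf b':\Omega\to\mathbb C^K$, then there is a permutation $\sigma$ of $\{1,\dots,K\}$ with $t'_k=t_{\sigma(k)}$ for all $k$ and $\mathbf b'_k=\mathbf b_{\sigma(k)}$ a.e. for all $k$; 4. if $p\ge K$, then $\mathbf a(e^{j\omega T})=\mathbf D^{-1}(e^{j\omega T},\tau)\,\mathbf N^\dagger(\tau)\,\mathbf d(e^{j\omega T})$ for a.e. $\omega\in\Omega$, where $\mathbf N^\dagger$ is the Moore–Penrose pseudo-inverse. -/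

import Mathlib

open MeasureTheory Filter Topology
open scoped Matrix FourierTransform ComplexConjugate

namespace TimeDelay

noncomputable section

/-- Complex-valued finite-energy signals on the real line. -/
abbrev Signal : Type := Lp ℂ 2 (volume : Measure ℝ)

/-- The delayed signal `t ↦ g (t - s)`. -/
def delay (s : ℝ) (g : Signal) : Signal :=
  Lp.compMeasurePreserving (fun t : ℝ => t - s) (measurePreserving_sub_right volume s) g

/-- The Fourier transform in angular frequency, `X(ω) = ∫ x(t) e^{-jωt} dt`, of a finite-energy
signal (defined up to null sets). Mathlib's transform uses the kernel `e^{-2πjξt}`. -/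
def ft (x : Signal) (ω : ℝ) : ℂ :=
  (𝓕 x : Signal) (ω / (2 * Real.pi))

/-- One period `Ω = [0, 2π/T)` of the discrete-time Fourier transform. -/
def period (T : ℝ) : Set ℝ := Set.Ico 0 (2 * Real.pi / T)

/-- The working band `𝓕 = [2πγ/T, 2π(p+γ)/T]`. -/
def band (T : ℝ) (γ : ℤ) (p : ℕ) : Set ℝ :=
  Set.Icc (2 * Real.pi / T * γ) (2 * Real.pi / T * (p + γ))

/-- The term `a[n] e^{-jωnT}` of the discrete-time Fourier transform. -/
def dtftTerm (T : ℝ) (a : ℤ → ℂ) (n : ℤ) (ω : ℝ) : ℂ :=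
  a n * Complex.exp (-(Complex.I * ω * n * T))

theorem memLp_dtftTerm (T : ℝ) (a : ℤ → ℂ) (n : ℤ) :
    MemLp (dtftTerm T a n) 2 (volume.restrict (period T)) := by
  have : IsFiniteMeasure (volume.restrict (period T)) :=
    ⟨by simp [period]⟩
  refine MemLp.of_bound (C := ‖a n‖) ?_ ?_
  · exact Continuous.aestronglyMeasurable (by unfold dtftTerm; fun_prop)
  · refine Filter.Eventually.of_forall fun ω => ?_
    have h : -(Complex.I * ω * n * T) = ((-(ω * n * T) : ℝ) : ℂ) * Complex.I := by
      push_cast; ring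
    rw [dtftTerm, norm_mul, h, Complex.norm_exp_ofReal_mul_I, mul_one]

/-- The discrete-time Fourier transform `∑ₙ a[n] e^{-jωnT}` of a square-summable sequence, as the
sum of this series in `L²(Ω)`. -/
def dtft (T : ℝ) (a : ℤ → ℂ) : Lp ℂ 2 (volume.restrict (period T)) :=
  ∑' n : ℤ, (memLp_dtftTerm T a n).toLp (dtftTerm T a n)

/-- `x(t) = ∑ₖ ∑ₙ aₖ[n] g(t - tₖ - nT)`, where the series is the limit in `L²(ℝ)` of its symmetric
partial sums. -/
def IsMultipathSignal {K : ℕ} (T : ℝ) (g : Signal) (t : Fin K → ℝ) (a : Fin K → ℤ → ℂ)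
    (x : Signal) : Prop :=
  Tendsto (fun N : ℕ => ∑ k, ∑ n ∈ Finset.Icc (-(N : ℤ)) N, a k n • delay (t k + n * T) g)
    atTop (𝓝 x)

/-- The sample `c[n] = ⟨x(t), s(t - nT)⟩ = ∫ x(t) s*(t - nT) dt`. -/
def sample (T : ℝ) (x s : Signal) (n : ℤ) : ℂ :=
  ∫ t : ℝ, x t * conj (s (t - n * T))

/-- The vector of the discrete-time Fourier transforms of finitely many sequences. -/
def dtftVec {q : ℕ} (T : ℝ) (a : Fin q → ℤ → ℂ) (ω : ℝ) : Fin q → ℂ :=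
  fun k => dtft T (a k) ω

/-- The matrix `𝐒` with entries `(1/T) S_ℓ*(ω + (2π/T)(m + γ))`, `m = 0, …, p - 1`. -/
def matS {p : ℕ} (T : ℝ) (γ : ℤ) (s : Fin p → Signal) (ω : ℝ) : Matrix (Fin p) (Fin p) ℂ :=
  Matrix.of fun l m => 1 / (T : ℂ) * conj (ft (s l) (ω + 2 * Real.pi / T * ((m : ℕ) + γ)))

/-- The matrix `𝐖` with entries `(1/T) S_ℓ*(ω + (2π/T)(m + γ)) G(ω + (2π/T)(m + γ))`,
`m = 0, …, p - 1`. -/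
def matW {p : ℕ} (T : ℝ) (γ : ℤ) (s : Fin p → Signal) (g : Signal) (ω : ℝ) :
    Matrix (Fin p) (Fin p) ℂ :=
  Matrix.of fun l m =>
    1 / (T : ℂ) * conj (ft (s l) (ω + 2 * Real.pi / T * ((m : ℕ) + γ))) *
      ft g (ω + 2 * Real.pi / T * ((m : ℕ) + γ))

/-- The Vandermonde matrix `𝐍(τ)` with entries `e^{-j(2π/T)(m + γ)tₖ}`, `m = 0, …, p - 1`. -/
def matN {K : ℕ} (p : ℕ) (T : ℝ) (γ : ℤ) (t : Fin K → ℝ) : Matrix (Fin p) (Fin K) ℂ :=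
  Matrix.of fun m k =>
    Complex.exp (-(Complex.I * (2 * Real.pi / T) * ((m : ℕ) + γ) * t k))

/-- The diagonal matrix `𝐃` with diagonal entries `e^{-jωtₖ}`. -/
def matD {K : ℕ} (t : Fin K → ℝ) (ω : ℝ) : Matrix (Fin K) (Fin K) ℂ :=
  Matrix.diagonal fun k => Complex.exp (-(Complex.I * ω * t k))

/-- A matrix function on `Ω` is stably invertible a.e.: its singular values lie between two positive
constants for almost every `ω ∈ Ω`. -/
def StablyInvertible {p : ℕ} (T : ℝ) (M : ℝ → Matrix (Fin p) (Fin p) ℂ) : Prop :=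
  ∃ α β : ℝ, 0 < α ∧ ∀ᵐ ω ∂volume.restrict (period T), ∀ v : EuclideanSpace ℂ (Fin p),
    α * ‖v‖ ≤ ‖Matrix.toEuclideanLin (M ω) v‖ ∧ ‖Matrix.toEuclideanLin (M ω) v‖ ≤ β * ‖v‖

/-- The vector `𝐛 = 𝐃 𝐚`. -/
def vecB {K : ℕ} (T : ℝ) (t : Fin K → ℝ) (a : Fin K → ℤ → ℂ) (ω : ℝ) : Fin K → ℂ :=
  matD t ω *ᵥ dtftVec T a ω

/-- The modified measurement vector `𝐝 = 𝐖⁻¹ 𝐜`. -/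
def vecD {p : ℕ} (T : ℝ) (γ : ℤ) (s : Fin p → Signal) (g x : Signal) (ω : ℝ) : Fin p → ℂ :=
  (matW T γ s g ω)⁻¹ *ᵥ dtftVec T (fun l => sample T x (s l)) ω

/-- The four Penrose equations. -/
structure IsMoorePenrose {m n : ℕ} (A : Matrix (Fin m) (Fin n) ℂ)
    (P : Matrix (Fin n) (Fin m) ℂ) : Prop where
  mul_mul_self : A * P * A = A
  self_mul_mul : P * A * P = P
  left_herm : (A * P)ᴴ = A * P
  right_herm : (P * A)ᴴ = P * A

theorem IsMoorePenrose.unique {m n : ℕ} {A : Matrix (Fin m) (Fin n) ℂ}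
    {P Q : Matrix (Fin n) (Fin m) ℂ} (hP : IsMoorePenrose A P) (hQ : IsMoorePenrose A Q) :
    P = Q := by
  have h1 : A * P = A * Q := by
    calc A * P = (A * P)ᴴ := hP.left_herm.symm
      _ = (A * Q * (A * P))ᴴ := by rw [← Matrix.mul_assoc, hQ.mul_mul_self]
      _ = A * P * (A * Q) := by rw [Matrix.conjTranspose_mul, hP.left_herm, hQ.left_herm]
      _ = A * Q := by rw [← Matrix.mul_assoc, hP.mul_mul_self]
  have h2 : P * A = Q * A := by
    calc P * A = (P * A)ᴴ := hP.right_herm.symm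
      _ = (P * A * (Q * A))ᴴ := by
        rw [Matrix.mul_assoc, ← Matrix.mul_assoc A, hQ.mul_mul_self]
      _ = Q * A * (P * A) := by rw [Matrix.conjTranspose_mul, hP.right_herm, hQ.right_herm]
      _ = Q * A := by rw [Matrix.mul_assoc, ← Matrix.mul_assoc A, hP.mul_mul_self]
  calc P = P * A * P := hP.self_mul_mul.symm
    _ = Q * A * Q := by rw [h2, Matrix.mul_assoc, h1, Matrix.mul_assoc]
    _ = Q := hQ.self_mul_mul

theorem IsMoorePenrose.exists {m n : ℕ} (A : Matrix (Fin m) (Fin n) ℂ) :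
    ∃ P, IsMoorePenrose A P := by
  have hH : (Aᴴ * A).IsHermitian := Matrix.isHermitian_conjTranspose_mul_self A
  have key : ∀ H : Matrix (Fin n) (Fin n) ℂ, H.IsHermitian → ∃ B : Matrix (Fin n) (Fin n) ℂ,
      Bᴴ = B ∧ B * H * B = B ∧ H * B * H = H ∧ B * H = H * B := by
    intro H hH
    obtain ⟨e, d, hs⟩ : ∃ (e : Matrix (Fin n) (Fin n) ℂ ≃⋆ₐ[ℂ] Matrix (Fin n) (Fin n) ℂ)
        (d : Fin n → ℝ), H = e (Matrix.diagonal fun i => (d i : ℂ)) :=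
      ⟨_, _, hH.spectral_theorem⟩
    refine ⟨e (Matrix.diagonal fun i => (d i : ℂ)⁻¹), ?_, ?_, ?_, ?_⟩
    · rw [← Matrix.star_eq_conjTranspose, ← map_star, Matrix.star_eq_conjTranspose,
        Matrix.diagonal_conjTranspose]
      congr 2
      ext i
      simp
    all_goals
      simp only [hs, ← map_mul, Matrix.diagonal_mul_diagonal]
      congr 2
      ext i
      by_cases h : d i = 0 <;> simp [h]
  obtain ⟨B, hB, hBHB, hHBH, hc⟩ := key _ hH
  refine ⟨B * Aᴴ, ?_, ?_, ?_, ?_⟩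
  · have h0 : (A * B * (Aᴴ * A) - A)ᴴ * (A * B * (Aᴴ * A) - A) = 0 := by
      have h1 : Aᴴ * (A * B * (Aᴴ * A) - A) = 0 := by
        rw [Matrix.mul_sub, sub_eq_zero]
        simpa only [Matrix.mul_assoc] using hHBH
      have h2 : A * B * (Aᴴ * A) - A = A * (B * (Aᴴ * A) - 1) := by
        rw [Matrix.mul_sub, Matrix.mul_one, Matrix.mul_assoc]
      conv_lhs => rw [h2, Matrix.conjTranspose_mul, Matrix.mul_assoc, ← h2, h1, Matrix.mul_zero]
    open scoped ComplexOrder in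
    have := sub_eq_zero.mp (Matrix.conjTranspose_mul_self_eq_zero.mp h0)
    simpa only [Matrix.mul_assoc] using this
  · calc B * Aᴴ * A * (B * Aᴴ) = B * (Aᴴ * A) * B * Aᴴ := by simp only [Matrix.mul_assoc]
      _ = B * Aᴴ := by rw [hBHB]
  · simp only [Matrix.conjTranspose_mul, Matrix.conjTranspose_conjTranspose, hB, Matrix.mul_assoc]
  · rw [Matrix.mul_assoc, Matrix.conjTranspose_mul, hH.eq, hB, hc]

/-- The Moore–Penrose pseudo-inverse `A†`. -/
def pinv {m n : ℕ} (A : Matrix (Fin m) (Fin n) ℂ) : Matrix (Fin n) (Fin m) ℂ :=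
  Classical.choose (IsMoorePenrose.exists A)

theorem isMoorePenrose_pinv {m n : ℕ} (A : Matrix (Fin m) (Fin n) ℂ) :
    IsMoorePenrose A (pinv A) :=
  Classical.choose_spec (IsMoorePenrose.exists A)

end

end TimeDelay

open TimeDelay

namespace TimeDelay

/-! In frequency, path k contributes `G(ω) e^{-jωt_k} A_k(e^{jωT})`, where `A_k` has period `2π/T`.
Sampling at rate `1/T` adds up the `p` translates of `Ω` that make up the band, and translating by
`(2π/T)(m+γ)` changes only `S_ℓ`, `G` and the phase of the delay. This gives `𝐜 = 𝐖 𝐍 𝐃 𝐚`.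

The identity is proved weakly. Each partial sum of `x` is tested against the shifted kernels;
Parseval and folding turn every term into a Fourier coefficient on `Ω`
(`inner_delay_eq_inner_expLp`). Since `𝐖 = 𝐒 diag(G)` is stably invertible, the entries of `𝐖 𝐍 𝐃`
are bounded, so multiplication by them is continuous on `L²(Ω)` and the limit can be taken. The
samples are thus the Fourier coefficients of an `L²(Ω)` function, which gives both their
square-summability and their transform (`memℓp_and_dtft_eq_of_inner`).

The rest is linear algebra at almost every `ω`. Up to a nonzero factor per column, `𝐍` is
Vandermonde with nodes `e^{-j2πt_k/T}`, distinct for distinct delays in `[0,T)`. Two `K`-path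
descriptions involve at most `2K ≤ p` delays together, so their amplitudes agree delay by delay; a
delay missing from the second would force `b_k = 0` a.e., hence `a_k = 0`. For `K ≤ p`, `𝐍` is
injective and `𝐍†` is a left inverse. -/

/-! ### Delays and the Fourier transform on `L²(ℝ)` -/

theorem delay_ae_eq (s : ℝ) (g : Signal) : delay s g =ᵐ[volume] fun t => g (t - s) :=
  Lp.coeFn_compMeasurePreserving g (measurePreserving_sub_right volume s)

theorem isometry_delay (s : ℝ) : Isometry (delay s) :=
  Lp.isometry_compMeasurePreserving (measurePreserving_sub_right volume s)

theorem fourier_translate (f : ℝ → ℂ) (s ξ : ℝ) :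
    𝓕 (fun t => f (t - s)) ξ = Complex.exp (-(2 * Real.pi * Complex.I * ξ * s)) * 𝓕 f ξ := by
  rw [Real.fourier_real_eq_integral_exp_smul, Real.fourier_real_eq_integral_exp_smul,
    ← integral_const_mul,
    ← integral_sub_right_eq_self (fun v => Complex.exp (-(2 * Real.pi * Complex.I * ξ * s)) *
      (Complex.exp (↑(-2 * Real.pi * v * ξ) * Complex.I) • f v)) s]
  congr 1 with v
  rw [smul_eq_mul, smul_eq_mul, ← mul_assoc, ← Complex.exp_add]
  congr 2
  push_cast
  ring

theorem memLp_top_phase (s : ℝ) :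
    MemLp (fun ξ : ℝ => Complex.exp (-(2 * Real.pi * Complex.I * ξ * s))) ⊤ volume := by
  refine memLp_top_of_bound (Continuous.aestronglyMeasurable (by fun_prop)) 1
    (Eventually.of_forall fun ξ => ?_)
  have h : -(2 * Real.pi * Complex.I * ξ * s) = ((-(2 * Real.pi * ξ * s) : ℝ) : ℂ) * Complex.I := by
    push_cast; ring
  rw [h, Complex.norm_exp_ofReal_mul_I]

/-- The Fourier transform on `L²(ℝ)` turns delays into modulations. -/
theorem fourier_delay_ae_eq (s : ℝ) (g : Signal) :
    (𝓕 (delay s g) : Signal) =ᵐ[volume]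
      fun ξ : ℝ => Complex.exp (-(2 * Real.pi * Complex.I * ξ * s)) * (𝓕 g : Signal) ξ := by
  let M : Signal →L[ℂ] Signal :=
    (ContinuousLinearMap.mul ℂ ℂ).holderL volume ⊤ 2 2 ((memLp_top_phase s).toLp _)
  have hM : ∀ f : Signal, M f =ᵐ[volume]
      fun ξ : ℝ => Complex.exp (-(2 * Real.pi * Complex.I * ξ * s)) * f ξ := by
    intro f
    have h := (ContinuousLinearMap.mul ℂ ℂ).coeFn_holder (r := 2) ((memLp_top_phase s).toLp _) f
    filter_upwards [h, (memLp_top_phase s).coeFn_toLp] with ξ h1 h2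
    refine h1.trans ?_
    rw [ContinuousLinearMap.mul_apply', h2]
  suffices h : (𝓕 (delay s g) : Signal) = M (𝓕 g) by
    rw [h]; exact hM _
  -- Both sides are continuous in `g`, so it suffices to check Schwartz functions, where the
  -- transform is an integral.
  refine DenseRange.induction_on (p := fun g : Signal => (𝓕 (delay s g) : Signal) = M (𝓕 g))
    (SchwartzMap.denseRange_toLpCLM (E := ℝ) (F := ℂ) (μ := volume) (p := 2)
      ENNReal.ofNat_ne_top) g ?_ ?_
  · have hF : Continuous fun f : Signal => (𝓕 f : Signal) :=
      (Lp.fourierTransformₗᵢ ℝ ℂ).continuous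
    exact isClosed_eq (hF.comp (isometry_delay s).continuous) (M.continuous.comp hF)
  · intro f
    rw [SchwartzMap.toLpCLM_apply]
    have h1 : delay s (f.toLp 2) = (f.compSubConstCLM ℂ s).toLp 2 := rfl
    rw [h1, SchwartzMap.toLp_fourier_eq, SchwartzMap.toLp_fourier_eq]
    apply Lp.ext
    filter_upwards [hM ((𝓕 f).toLp 2), (𝓕 f).coeFn_toLp 2 volume,
      (𝓕 (f.compSubConstCLM ℂ s)).coeFn_toLp 2 volume] with ξ h2 h3 h4
    rw [h2, h3, h4, SchwartzMap.fourier_coe, SchwartzMap.fourier_coe, ← fourier_translate]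
    rfl

/-- The inner product is conjugate-linear in its first argument, so the kernel comes first. -/
theorem sample_eq_inner (T : ℝ) (x s : Signal) (n : ℤ) :
    sample T x s n = inner ℂ (delay (n * T) s) x := by
  rw [sample, L2.inner_def]
  refine integral_congr_ae ?_
  filter_upwards [delay_ae_eq (n * T) s] with t h
  rw [h, RCLike.inner_apply]

/-- Parseval's identity in angular frequency, for delayed signals. -/
theorem inner_delay_delay (u v : ℝ) (f h : Signal) :
    inner ℂ (delay u f) (delay v h) = ((1 / (2 * Real.pi) : ℝ) : ℂ) *
      ∫ ω : ℝ, conj (ft f ω) * ft h ω * Complex.exp (-(Complex.I * ω * (v - u))) := by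
  rw [← Lp.inner_fourier_eq, L2.inner_def]
  have h1 : ∫ ξ, inner ℂ ((𝓕 (delay u f) : Signal) ξ) ((𝓕 (delay v h) : Signal) ξ) =
      ∫ ξ : ℝ, (fun ω : ℝ => conj (ft f ω) * ft h ω * Complex.exp (-(Complex.I * ω * (v - u))))
        (2 * Real.pi * ξ) := by
    refine integral_congr_ae ?_
    filter_upwards [fourier_delay_ae_eq u f, fourier_delay_ae_eq v h] with ξ h2 h3
    rw [h2, h3, RCLike.inner_apply]
    simp only [ft]
    rw [mul_div_cancel_left₀ _ (by positivity), map_mul, ← Complex.exp_conj]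
    simp only [map_neg, map_mul, Complex.conj_I, Complex.conj_ofReal, map_ofNat]
    have : -(Complex.I * ((2 * Real.pi * ξ : ℝ) : ℂ) * (v - u)) =
      -(2 * Real.pi * Complex.I * ξ * v) + -(2 * Real.pi * (-Complex.I) * ξ * u) := by
      push_cast; ring
    rw [this, Complex.exp_add]
    ring
  rw [h1, Measure.integral_comp_mul_left (fun ω : ℝ =>
    conj (ft f ω) * ft h ω * Complex.exp (-(Complex.I * ω * (v - u)))), Complex.real_smul,
    abs_of_pos (by positivity), one_div]

theorem aestronglyMeasurable_ft (x : Signal) : AEStronglyMeasurable (ft x) volume := by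
  have h : Measure.QuasiMeasurePreserving (fun ω : ℝ => (2 * Real.pi)⁻¹ * ω) volume volume := by
    refine ⟨by fun_prop, ?_⟩
    rw [Real.map_volume_mul_left (by positivity)]
    exact Measure.smul_absolutelyContinuous
  have h2 := (Lp.aestronglyMeasurable (𝓕 x : Signal)).comp_quasiMeasurePreserving h
  refine h2.congr (Eventually.of_forall fun ω => ?_)
  simp only [Function.comp_apply, ft]
  rw [div_eq_inv_mul]

theorem integrable_ft_mul_ft (f h : Signal) :
    Integrable (fun ω => conj (ft f ω) * ft h ω) volume := by
  have h1 : Integrable (fun ξ => conj ((𝓕 f : Signal) ξ) * (𝓕 h : Signal) ξ) volume :=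
    (Lp.memLp (𝓕 f : Signal)).star.integrable_mul (Lp.memLp (𝓕 h : Signal))
  exact h1.comp_div (by positivity)

/-! ### Folding the band onto one period -/

/-- Folding of an integral over the band into integrals over one period. -/
theorem integral_eq_sum_integral_period {T : ℝ} (hT : 0 < T) (γ : ℤ) (p : ℕ) {f : ℝ → ℂ}
    (hf : Integrable f volume) (h0 : ∀ᵐ ω : ℝ, ω ∉ band T γ p → f ω = 0) :
    ∫ ω, f ω = ∑ m : Fin p, ∫ ω in period T, f (ω + 2 * Real.pi / T * ((m : ℕ) + γ)) := by
  set L := 2 * Real.pi / T with hL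
  have hL0 : 0 < L := by positivity
  have h1 : ∫ ω, f ω = ∫ ω in band T γ p, f ω :=
    (setIntegral_eq_integral_of_ae_compl_eq_zero h0).symm
  have h2 : ∀ m : ℕ, ∫ ω in period T, f (ω + L * ((m : ℕ) + γ)) =
      ∫ ω in (L * (m + γ))..(L * ((m + 1 : ℕ) + γ)), f ω := by
    intro m
    rw [period, integral_Ico_eq_integral_Ioc, ← intervalIntegral.integral_of_le hL0.le,
      intervalIntegral.integral_comp_add_right]
    congr 1 <;> push_cast <;> ring
  rw [Finset.sum_congr rfl fun (m : Fin p) _ => h2 m,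
    Fin.sum_univ_eq_sum_range (fun m : ℕ => ∫ ω in (L * (m + γ))..(L * ((m + 1 : ℕ) + γ)), f ω) p,
    -- The `p` translates of the period are adjacent and tile the band up to an endpoint.
    intervalIntegral.sum_integral_adjacent_intervals (a := fun m : ℕ => L * (m + γ))
      fun k _ => hf.intervalIntegrable,
    intervalIntegral.integral_of_le (by push_cast; gcongr; positivity), h1, band,
    integral_Icc_eq_integral_Ioc]
  simp [hL]

/-- Each of the `p` translates of `Ω` lies in the band, and translations preserve null sets. -/
theorem ae_period_shift {T : ℝ} (hT : 0 < T) (γ : ℤ) {p : ℕ} {P : ℝ → Prop}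
    (h : ∀ᵐ ω ∂volume.restrict (band T γ p), P ω) :
    ∀ᵐ ω ∂volume.restrict (period T), ∀ m : Fin p, P (ω + 2 * Real.pi / T * ((m : ℕ) + γ)) := by
  rw [ae_all_iff]
  intro m
  have hL0 : 0 < 2 * Real.pi / T := by positivity
  have h1 := (ae_restrict_iff' measurableSet_Icc).1 h
  rw [period, ae_restrict_iff' measurableSet_Ico]
  filter_upwards [(quasiMeasurePreserving_add_right volume
    (2 * Real.pi / T * ((m : ℕ) + γ))).ae h1] with ω h2 h3
  have h4 : ((m : ℕ) : ℝ) + 1 ≤ p := by exact_mod_cast m.2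
  have h5 := mul_le_mul_of_nonneg_left h4 hL0.le
  have h6 : 0 ≤ 2 * Real.pi / T * ((m : ℕ) : ℝ) := by positivity
  rw [mul_add, mul_one] at h5
  refine h2 ⟨?_, ?_⟩
  · rw [mul_add]; linarith [h3.1]
  · rw [mul_add, mul_add]; linarith [h3.2]

/-! ### Fourier series on `Ω` and the discrete-time Fourier transform -/

noncomputable section

/-- The exponential `e^{-jωnT}` as an element of `L²(Ω)`. -/
def expLp (T : ℝ) (n : ℤ) : Lp ℂ 2 (volume.restrict (period T)) :=
  (memLp_dtftTerm T 1 n).toLp (dtftTerm T 1 n)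

theorem expLp_ae_eq (T : ℝ) (n : ℤ) : expLp T n =ᵐ[volume.restrict (period T)]
    fun ω : ℝ => Complex.exp (-(Complex.I * ω * n * T)) := by
  filter_upwards [(memLp_dtftTerm T 1 n).coeFn_toLp] with ω h
  rw [expLp, h, dtftTerm, Pi.one_apply, one_mul]

theorem toLp_dtftTerm (T : ℝ) (a : ℤ → ℂ) (n : ℤ) :
    (memLp_dtftTerm T a n).toLp (dtftTerm T a n) = a n • expLp T n := by
  rw [expLp, ← MemLp.toLp_const_smul]
  refine MemLp.toLp_congr _ _ (Eventually.of_forall fun ω => ?_)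
  simp [dtftTerm]

theorem inner_expLp (T : ℝ) (n : ℤ) (f : Lp ℂ 2 (volume.restrict (period T))) :
    inner ℂ (expLp T n) f =
      ∫ ω in period T, f ω * Complex.exp (Complex.I * ω * n * T) := by
  rw [L2.inner_def]
  refine integral_congr_ae ?_
  filter_upwards [expLp_ae_eq T n] with ω h
  rw [h, RCLike.inner_apply, ← Complex.exp_conj]
  simp

theorem inner_expLp_expLp {T : ℝ} (hT : 0 < T) (m n : ℤ) :
    inner ℂ (expLp T m) (expLp T n) = if m = n then ((2 * Real.pi / T : ℝ) : ℂ) else 0 := by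
  have hL : 0 < 2 * Real.pi / T := by positivity
  have hT' : (T : ℂ) ≠ 0 := by exact_mod_cast hT.ne'
  have h1 : inner ℂ (expLp T m) (expLp T n) =
      ∫ ω : ℝ in 0..(2 * Real.pi / T), Complex.exp (Complex.I * (m - n : ℤ) * T * ω) := by
    rw [inner_expLp, intervalIntegral.integral_of_le hL.le, ← integral_Ico_eq_integral_Ioc]
    refine integral_congr_ae ?_
    filter_upwards [expLp_ae_eq T n] with ω h
    rw [h, ← Complex.exp_add]
    congr 1
    push_cast
    ring
  rw [h1]
  split_ifs with h
  · simp [h]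
  · have hc : Complex.I * ((m - n : ℤ) : ℂ) * T ≠ 0 :=
      mul_ne_zero (mul_ne_zero Complex.I_ne_zero (by exact_mod_cast sub_ne_zero.2 h)) hT'
    rw [integral_exp_mul_complex hc]
    have h2 : Complex.I * ((m - n : ℤ) : ℂ) * T * ((2 * Real.pi / T : ℝ) : ℂ) =
        ((m - n : ℤ) : ℂ) * (2 * Real.pi * Complex.I) := by
      push_cast; field_simp
    rw [h2, Complex.exp_int_mul_two_pi_mul_I]
    simp

/-- Completeness of the exponentials: by Parseval for Fourier series, vanishing coefficients force
the `L²` norm to vanish. -/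
theorem eq_zero_of_inner_expLp_eq_zero {T : ℝ} (hT : 0 < T)
    {f : Lp ℂ 2 (volume.restrict (period T))} (h : ∀ n, inner ℂ (expLp T n) f = 0) : f = 0 := by
  have hL : 0 < 2 * Real.pi / T := by positivity
  have hres : volume.restrict (Set.Ioc 0 (2 * Real.pi / T)) = volume.restrict (period T) :=
    (Measure.restrict_congr_set Ico_ae_eq_Ioc).symm
  have hf : MemLp f 2 (volume.restrict (Set.Ioc 0 (2 * Real.pi / T))) := by
    rw [hres]; exact Lp.memLp f
  have hc : ∀ n, fourierCoeffOn hL f n = 0 := by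
    intro n
    rw [fourierCoeffOn_eq_integral, intervalIntegral.integral_of_le hL.le, hres]
    -- The sign flips because `expLp T n` has frequency `-n` in the convention of `fourierCoeffOn`.
    have h2 := h (-n)
    rw [inner_expLp] at h2
    rw [smul_eq_zero]
    right
    rw [← h2]
    congr 1 with ω
    rw [fourier_coe_apply, smul_eq_mul, mul_comm]
    congr 2
    push_cast
    have hT' : (T : ℂ) ≠ 0 := by exact_mod_cast hT.ne'
    have hpi : (Real.pi : ℂ) ≠ 0 := by exact_mod_cast Real.pi_ne_zero
    field_simp
    ring
  have hs := tsum_sq_fourierCoeffOn hL hf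
  simp only [hc, norm_zero, ne_eq, OfNat.ofNat_ne_zero, not_false_eq_true, zero_pow, tsum_zero,
    sub_zero] at hs
  rw [intervalIntegral.integral_of_le hL.le, hres, eq_comm, smul_eq_zero,
    or_iff_right (inv_pos.2 hL).ne',
    integral_eq_zero_iff_of_nonneg (fun _ => by positivity)
      ((memLp_two_iff_integrable_sq_norm (Lp.aestronglyMeasurable f)).1 (Lp.memLp f))] at hs
  apply Lp.ext
  filter_upwards [hs, Lp.coeFn_zero ℂ 2 (volume.restrict (period T))] with ω h1 h2
  rw [h2]
  simpa using h1

theorem orthonormal_smul_expLp {T : ℝ} (hT : 0 < T) :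
    Orthonormal ℂ fun n => ((√(T / (2 * Real.pi)) : ℝ) : ℂ) • expLp T n := by
  rw [orthonormal_iff_ite]
  intro m n
  rw [inner_smul_left, inner_smul_right, inner_expLp_expLp hT]
  split_ifs
  · rw [Complex.conj_ofReal, ← Complex.ofReal_mul, ← Complex.ofReal_mul, ← mul_assoc,
      Real.mul_self_sqrt (by positivity)]
    have : T / (2 * Real.pi) * (2 * Real.pi / T) = 1 := by field_simp
    rw [this, Complex.ofReal_one]
  · simp

theorem sqrt_ne_zero_of_pos {T : ℝ} (hT : 0 < T) : ((√(T / (2 * Real.pi)) : ℝ) : ℂ) ≠ 0 := by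
  have : 0 < √(T / (2 * Real.pi)) := Real.sqrt_pos.2 (by positivity)
  exact_mod_cast this.ne'

/-- The normalized exponentials form a Hilbert basis of `L²(Ω)`. -/
def expBasis {T : ℝ} (hT : 0 < T) : HilbertBasis ℤ ℂ (Lp ℂ 2 (volume.restrict (period T))) :=
  HilbertBasis.mkOfOrthogonalEqBot (orthonormal_smul_expLp hT) <| by
    rw [Submodule.eq_bot_iff]
    intro f hf
    refine eq_zero_of_inner_expLp_eq_zero hT fun n => ?_
    have h := (Submodule.mem_orthogonal _ _).1 hf _ (Submodule.subset_span ⟨n, rfl⟩)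
    rw [inner_smul_left, mul_eq_zero, Complex.conj_ofReal] at h
    exact h.resolve_left (sqrt_ne_zero_of_pos hT)

theorem expBasis_apply {T : ℝ} (hT : 0 < T) (n : ℤ) :
    expBasis hT n = ((√(T / (2 * Real.pi)) : ℝ) : ℂ) • expLp T n := by
  rw [expBasis, HilbertBasis.coe_mkOfOrthogonalEqBot]

/-- Summability has to be established, since the `tsum` in `dtft` defaults to zero without it; it
comes from the Hilbert basis after rescaling. -/
theorem hasSum_dtft {T : ℝ} (hT : 0 < T) {a : ℤ → ℂ} (ha : Memℓp a 2) :
    HasSum (fun n => a n • expLp T n) (dtft T a) := by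
  have h1 := ((expBasis hT).hasSum_repr_symm ⟨a, ha⟩).const_smul
    (((√(T / (2 * Real.pi)) : ℝ) : ℂ)⁻¹)
  have h2 : (fun n => ((√(T / (2 * Real.pi)) : ℝ) : ℂ)⁻¹ • (a n • expBasis hT n)) =
      fun n => a n • expLp T n := by
    funext n
    rw [expBasis_apply, smul_comm (a n), smul_smul, inv_mul_cancel₀ (sqrt_ne_zero_of_pos hT),
      one_smul]
  have h3 : Summable fun n => a n • expLp T n := by
    rw [← h2]; exact h1.summable
  have h4 : dtft T a = ∑' n, a n • expLp T n := by
    simp only [dtft, toLp_dtftTerm]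
  rw [h4]
  exact h3.hasSum

theorem inner_expLp_dtft {T : ℝ} (hT : 0 < T) {a : ℤ → ℂ} (ha : Memℓp a 2) (n : ℤ) :
    inner ℂ (expLp T n) (dtft T a) = ((2 * Real.pi / T : ℝ) : ℂ) * a n := by
  have h := (hasSum_dtft hT ha).mapL (innerSL ℂ (expLp T n))
  have h1 : (fun m => innerSL ℂ (expLp T n) (a m • expLp T m)) =
      fun m => if m = n then ((2 * Real.pi / T : ℝ) : ℂ) * a n else 0 := by
    funext m
    rw [innerSL_apply_apply, inner_smul_right, inner_expLp_expLp hT]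
    by_cases hmn : n = m
    · simp [hmn, mul_comm]
    · simp [hmn, Ne.symm hmn]
  rw [h1] at h
  exact h.unique (hasSum_ite_eq n _)

theorem dtft_ne_zero {T : ℝ} (hT : 0 < T) {a : ℤ → ℂ} (ha : Memℓp a 2) (h0 : a ≠ 0) :
    dtft T a ≠ 0 := by
  intro h
  refine h0 (funext fun n => ?_)
  have h1 := inner_expLp_dtft hT ha n
  rw [h, inner_zero_right, eq_comm, mul_eq_zero] at h1
  refine h1.resolve_left ?_
  have : 0 < 2 * Real.pi / T := by positivity
  exact_mod_cast this.ne'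

/-- A sequence of Fourier coefficients of `f ∈ L²(Ω)` is square-summable, with discrete-time
Fourier transform `f`. -/
theorem memℓp_and_dtft_eq_of_inner {T : ℝ} (hT : 0 < T) {c : ℤ → ℂ}
    {f : Lp ℂ 2 (volume.restrict (period T))}
    (h : ∀ n, c n = ((T / (2 * Real.pi) : ℝ) : ℂ) * inner ℂ (expLp T n) f) :
    Memℓp c 2 ∧ dtft T c = f := by
  have hc : Memℓp c 2 := by
    -- The coordinates in the normalized basis carry one factor `√(T/2π)`; the second one completes
    -- `T/2π`.
    have h1 := (lp.memℓp ((expBasis hT).repr f)).const_smul ((√(T / (2 * Real.pi)) : ℝ) : ℂ)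
    have h2 : c = ((√(T / (2 * Real.pi)) : ℝ) : ℂ) • ⇑((expBasis hT).repr f) := by
      funext n
      rw [Pi.smul_apply, HilbertBasis.repr_apply_apply, expBasis_apply, inner_smul_left, h,
        Complex.conj_ofReal, smul_eq_mul, ← mul_assoc, ← Complex.ofReal_mul,
        Real.mul_self_sqrt (by positivity)]
    rw [h2]
    exact h1
  refine ⟨hc, ?_⟩
  rw [← sub_eq_zero]
  refine eq_zero_of_inner_expLp_eq_zero hT fun n => ?_
  rw [inner_sub_right, inner_expLp_dtft hT hc, h, ← mul_assoc, ← Complex.ofReal_mul]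
  have : 2 * Real.pi / T * (T / (2 * Real.pi)) = 1 := by field_simp
  rw [this, Complex.ofReal_one, one_mul, sub_self]

end

/-! ### The Vandermonde matrix of the delays -/

/-- Equal exponentials mean that `u` and `v` differ by a multiple of `T`, and `[0,T)` leaves room
only for zero. -/
theorem exp_eq_exp_of_mem_Ico {T : ℝ} (hT : 0 < T) {u v : ℝ} (hu : u ∈ Set.Ico 0 T)
    (hv : v ∈ Set.Ico 0 T)
    (h : Complex.exp (-(Complex.I * (2 * Real.pi / T) * u)) =
      Complex.exp (-(Complex.I * (2 * Real.pi / T) * v))) : u = v := by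
  obtain ⟨n, hn⟩ := Complex.exp_eq_exp_iff_exists_int.1 h
  have hT' : (T : ℂ) ≠ 0 := by exact_mod_cast hT.ne'
  have hpi : (Real.pi : ℂ) ≠ 0 := by exact_mod_cast Real.pi_ne_zero
  have h1 : (v : ℂ) = u + n * T := by
    have h2 : (2 * Real.pi * Complex.I) * (v - u - n * T) = 0 := by
      field_simp at hn
      linear_combination (2 * Real.pi * Complex.I) * hn
    rcases mul_eq_zero.1 h2 with h3 | h3
    · exact absurd h3 Complex.two_pi_I_ne_zero
    · linear_combination h3
  have h2 : v = u + n * T := by exact_mod_cast h1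
  have h3 : n = 0 := by
    have h4 : (n : ℝ) < 1 := by
      by_contra! h5
      nlinarith [hu.1, hv.2]
    have h6 : (-1 : ℝ) < n := by
      by_contra! h5
      nlinarith [hu.2, hv.1]
    have h7 : n < 1 := by exact_mod_cast h4
    have h8 : -1 < n := by exact_mod_cast h6
    omega
  rw [h2, h3]
  simp

/-- At most `p` distinct delays give linearly independent columns of exponentials. -/
theorem eq_zero_of_sum_exp_eq_zero {T : ℝ} (hT : 0 < T) (γ : ℤ) {p : ℕ} {S : Finset ℝ}
    (hS : ∀ u ∈ S, u ∈ Set.Ico 0 T) (hp : S.card ≤ p) {w : ℝ → ℂ}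
    (h : ∀ m : Fin p, ∑ u ∈ S,
      Complex.exp (-(Complex.I * (2 * Real.pi / T) * ((m : ℕ) + γ) * u)) * w u = 0) :
    ∀ u ∈ S, w u = 0 := by
  let e := S.equivFin
  let z : Fin S.card → ℂ := fun i =>
    Complex.exp (-(Complex.I * (2 * Real.pi / T) * ((e.symm i : ℝ) : ℂ)))
  -- The `γ`-part of the phase does not depend on the row; moving it into the coefficient leaves the
  -- pure powers `z i ^ m`.
  let v : Fin S.card → ℂ := fun i =>
    Complex.exp (-(Complex.I * (2 * Real.pi / T) * γ * ((e.symm i : ℝ) : ℂ))) * w (e.symm i)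
  have hz : Function.Injective z := by
    intro i j hij
    have h1 := exp_eq_exp_of_mem_Ico hT (hS _ (e.symm i).2) (hS _ (e.symm j).2) hij
    exact e.symm.injective (Subtype.ext h1)
  have hv : v = 0 := by
    refine Matrix.eq_zero_of_forall_pow_sum_mul_pow_eq_zero hz fun m => ?_
    have h1 := h ⟨m, m.2.trans_le hp⟩
    rw [← Finset.sum_coe_sort S, ← e.symm.sum_comp] at h1
    rw [← h1]
    refine Finset.sum_congr rfl fun i _ => ?_
    simp only [v, z]
    rw [← Complex.exp_nat_mul, mul_right_comm, ← Complex.exp_add]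
    congr 2
    ring
  intro u hu
  have h1 := congrFun hv (e ⟨u, hu⟩)
  simpa [v] using h1

theorem matN_mulVec_injective {K p : ℕ} {T : ℝ} (hT : 0 < T) (γ : ℤ) {t : Fin K → ℝ}
    (ht : ∀ k, t k ∈ Set.Ico 0 T) (ht_inj : Function.Injective t) (hp : K ≤ p) :
    Function.Injective (matN p T γ t).mulVec := by
  rw [← Matrix.coe_mulVecLin, ← LinearMap.ker_eq_bot, LinearMap.ker_eq_bot']
  intro b hb
  have h1 := eq_zero_of_sum_exp_eq_zero hT γ (p := p) (S := Finset.univ.image t)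
    (w := Function.extend t b 0) (by simpa using ht)
    (by rw [Finset.card_image_of_injective _ ht_inj]; simpa using hp) (by
      intro m
      rw [Finset.sum_image fun _ _ _ _ h => ht_inj h]
      have h2 := congrFun hb m
      simpa [Matrix.mulVec, dotProduct, matN, ht_inj.extend_apply] using h2)
  funext k
  have h2 := h1 (t k) (by simp)
  rwa [ht_inj.extend_apply] at h2

/-- If two `K`-path descriptions agree on `p ≥ 2K` rows, then they have the same amplitude at every
delay. -/
theorem sum_ite_eq_of_matN_mulVec_eq {K p : ℕ} {T : ℝ} (hT : 0 < T) (γ : ℤ) {t t' : Fin K → ℝ}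
    (ht : ∀ k, t k ∈ Set.Ico 0 T) (ht' : ∀ k, t' k ∈ Set.Ico 0 T) (hp : 2 * K ≤ p)
    {b b' : Fin K → ℂ} (h : matN p T γ t *ᵥ b = matN p T γ t' *ᵥ b') (u : ℝ) :
    ∑ k, (if t k = u then b k else 0) = ∑ k, (if t' k = u then b' k else 0) := by
  -- Regroups a sum over paths as a sum over delays, so that both descriptions can be subtracted on
  -- the common set `S`.
  have hsum : ∀ (S : Finset ℝ) (q : Fin K → ℝ) (c : Fin K → ℂ) (f : ℝ → ℂ), (∀ k, q k ∈ S) →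
      ∑ u ∈ S, f u * ∑ k, (if q k = u then c k else 0) = ∑ k, f (q k) * c k := by
    intro S q c f hq
    simp_rw [Finset.mul_sum]
    rw [Finset.sum_comm]
    refine Finset.sum_congr rfl fun k _ => ?_
    simp [hq k]
  let S := Finset.univ.image t ∪ Finset.univ.image t'
  by_cases hu : u ∈ S
  · refine sub_eq_zero.1 (eq_zero_of_sum_exp_eq_zero hT γ (p := p) (S := S)
      (w := fun u => ∑ k, (if t k = u then b k else 0) - ∑ k, (if t' k = u then b' k else 0))
      ?_ ?_ ?_ u hu)
    · intro u hu
      simp only [S, Finset.mem_union, Finset.mem_image, Finset.mem_univ, true_and] at hu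
      rcases hu with ⟨k, rfl⟩ | ⟨k, rfl⟩
      exacts [ht k, ht' k]
    · calc S.card ≤ (Finset.univ.image t).card + (Finset.univ.image t').card :=
            Finset.card_union_le _ _
        _ ≤ K + K := by
            gcongr <;> exact Finset.card_image_le.trans (by simp)
        _ ≤ p := by omega
    · intro m
      simp_rw [mul_sub]
      rw [Finset.sum_sub_distrib, hsum S t b _ fun k => by simp [S],
        hsum S t' b' _ fun k => by simp [S], sub_eq_zero]
      exact congrFun h m
  · simp only [S, Finset.mem_union, Finset.mem_image, Finset.mem_univ, true_and, not_or,
      not_exists] at hu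
    simp [hu.1, hu.2]

/-! ### Pseudo-inverse and stable invertibility -/

/-- Injectivity cancels the left factor `A` in `A A† A = A`. -/
theorem pinv_mul_self_of_injective {m n : ℕ} {A : Matrix (Fin m) (Fin n) ℂ}
    (hA : Function.Injective A.mulVec) : pinv A * A = 1 := by
  apply Matrix.mulVec_injective
  funext v
  apply hA
  rw [Matrix.mulVec_mulVec, ← Matrix.mul_assoc, (isMoorePenrose_pinv A).mul_mul_self,
    Matrix.one_mulVec]

theorem isUnit_det_matD {K : ℕ} (t : Fin K → ℝ) (ω : ℝ) : IsUnit (matD t ω).det := by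
  rw [matD, Matrix.det_diagonal, isUnit_iff_ne_zero]
  exact Finset.prod_ne_zero_iff.2 fun k _ => Complex.exp_ne_zero _

theorem matW_eq_mul_diagonal {p : ℕ} (T : ℝ) (γ : ℤ) (s : Fin p → Signal) (g : Signal) (ω : ℝ) :
    matW T γ s g ω = matS T γ s ω *
      Matrix.diagonal fun m : Fin p => ft g (ω + 2 * Real.pi / T * ((m : ℕ) + γ)) := by
  ext l m
  simp [matW, matS, Matrix.mul_diagonal]

theorem norm_toEuclideanLin_diagonal_mem {p : ℕ} {d : Fin p → ℂ} {α β : ℝ} (hα : 0 ≤ α)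
    (hd : ∀ m, α ≤ ‖d m‖ ∧ ‖d m‖ ≤ β) (v : EuclideanSpace ℂ (Fin p)) :
    α * ‖v‖ ≤ ‖Matrix.toEuclideanLin (Matrix.diagonal d) v‖ ∧
      ‖Matrix.toEuclideanLin (Matrix.diagonal d) v‖ ≤ |β| * ‖v‖ := by
  have h1 : ‖Matrix.toEuclideanLin (Matrix.diagonal d) v‖ ^ 2 = ∑ m, (‖d m‖ * ‖v m‖) ^ 2 := by
    rw [EuclideanSpace.norm_sq_eq]
    refine Finset.sum_congr rfl fun m _ => ?_
    rw [← norm_mul]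
    simp [Matrix.toEuclideanLin, Matrix.mulVec_diagonal]
  constructor
  · refine le_of_sq_le_sq ?_ (norm_nonneg _)
    rw [h1, mul_pow, EuclideanSpace.norm_sq_eq, Finset.mul_sum]
    refine Finset.sum_le_sum fun m _ => ?_
    rw [← mul_pow]
    gcongr
    exact (hd m).1
  · refine le_of_sq_le_sq ?_ (by positivity)
    rw [h1, mul_pow, EuclideanSpace.norm_sq_eq, Finset.mul_sum]
    refine Finset.sum_le_sum fun m _ => ?_
    rw [← mul_pow]
    gcongr
    exact (hd m).2.trans (le_abs_self β)

theorem stablyInvertible_matW {p : ℕ} {T : ℝ} (hT : 0 < T) {γ : ℤ} {s : Fin p → Signal}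
    {g : Signal} (hG : ∃ α β : ℝ, 0 < α ∧
      ∀ᵐ ω ∂volume.restrict (band T γ p), α ≤ ‖ft g ω‖ ∧ ‖ft g ω‖ ≤ β)
    (hS : StablyInvertible T (matS T γ s)) : StablyInvertible T (matW T γ s g) := by
  obtain ⟨α, β, hα, hG⟩ := hG
  obtain ⟨α', β', hα', hS⟩ := hS
  -- No sign is known for the upper constants (for `p = 0` their bounds say nothing), hence the
  -- absolute values.
  refine ⟨α' * α, |β'| * |β|, mul_pos hα' hα, ?_⟩
  filter_upwards [hS, ae_period_shift hT γ hG] with ω h1 h2 v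
  have h3 := norm_toEuclideanLin_diagonal_mem hα.le h2 v
  set d := Matrix.toEuclideanLin (Matrix.diagonal fun m : Fin p =>
    ft g (ω + 2 * Real.pi / T * ((m : ℕ) + γ))) v with hd
  have h4 : Matrix.toEuclideanLin (matW T γ s g ω) v = Matrix.toEuclideanLin (matS T γ s ω) d := by
    rw [hd, matW_eq_mul_diagonal]
    simp [Matrix.toEuclideanLin]
  rw [h4]
  constructor
  · calc α' * α * ‖v‖ = α' * (α * ‖v‖) := mul_assoc _ _ _
      _ ≤ α' * ‖d‖ := by gcongr; exact h3.1
      _ ≤ _ := (h1 d).1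
  · calc _ ≤ β' * ‖d‖ := (h1 d).2
      _ ≤ |β'| * ‖d‖ := by gcongr; exact le_abs_self β'
      _ ≤ |β'| * (|β| * ‖v‖) := by gcongr; exact h3.2
      _ = _ := (mul_assoc _ _ _).symm

/-- An entry is a coordinate of the image of a unit vector. This bound makes the transfer functions
`L^∞` multipliers. -/
theorem StablyInvertible.ae_norm_le {p : ℕ} {T : ℝ} {M : ℝ → Matrix (Fin p) (Fin p) ℂ}
    (hM : StablyInvertible T M) :
    ∃ C : ℝ, ∀ᵐ ω ∂volume.restrict (period T), ∀ l m, ‖M ω l m‖ ≤ C := by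
  obtain ⟨α, β, -, h⟩ := hM
  refine ⟨β, ?_⟩
  filter_upwards [h] with ω h l m
  have h1 := (h (EuclideanSpace.single m 1)).2
  rw [PiLp.norm_single, norm_one, mul_one] at h1
  refine le_trans ?_ h1
  refine le_trans (le_of_eq ?_) (PiLp.norm_apply_le _ l)
  simp [Matrix.toEuclideanLin]

theorem StablyInvertible.ae_isUnit_det {p : ℕ} {T : ℝ} {M : ℝ → Matrix (Fin p) (Fin p) ℂ}
    (hM : StablyInvertible T M) :
    ∀ᵐ ω ∂volume.restrict (period T), IsUnit (M ω).det := by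
  obtain ⟨α, β, hα, h⟩ := hM
  filter_upwards [h] with ω h
  rw [← Matrix.isUnit_iff_isUnit_det, ← Matrix.mulVec_injective_iff_isUnit,
    ← Matrix.coe_mulVecLin, ← LinearMap.ker_eq_bot, LinearMap.ker_eq_bot']
  intro v hv
  have h1 := (h (WithLp.toLp 2 v)).1
  have h2 : Matrix.toEuclideanLin (M ω) (WithLp.toLp 2 v) = 0 := by
    have h3 : M ω *ᵥ v = 0 := hv
    simp [Matrix.toEuclideanLin, h3]
  rw [h2, norm_zero] at h1
  have h3 : ‖WithLp.toLp 2 v‖ = 0 :=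
    le_antisymm (by by_contra! h4; nlinarith [mul_pos hα h4]) (norm_nonneg _)
  simpa using h3

/-! ### The samples as Fourier coefficients on `Ω` -/

noncomputable section

/-- The transfer function from the `k`-th sequence to the `l`-th sample sequence: the entry of
`𝐖 𝐍(τ) 𝐃`. -/
def transfer {K p : ℕ} (T : ℝ) (γ : ℤ) (s : Fin p → Signal) (g : Signal) (t : Fin K → ℝ)
    (l : Fin p) (k : Fin K) (ω : ℝ) : ℂ :=
  ∑ m, matW T γ s g ω l m * matN p T γ t m k * Complex.exp (-(Complex.I * ω * t k))

theorem norm_exp_neg_I_mul (ω u : ℝ) : ‖Complex.exp (-(Complex.I * ω * u))‖ = 1 := by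
  have h : -(Complex.I * ω * u) = ((-(ω * u) : ℝ) : ℂ) * Complex.I := by
    push_cast; ring
  rw [h, Complex.norm_exp_ofReal_mul_I]

theorem norm_matN {K : ℕ} (p : ℕ) (T : ℝ) (γ : ℤ) (t : Fin K → ℝ) (m : Fin p) (k : Fin K) :
    ‖matN p T γ t m k‖ = 1 := by
  have h := norm_exp_neg_I_mul (2 * Real.pi / T * ((m : ℕ) + γ)) (t k)
  rw [← h, matN, Matrix.of_apply]
  congr 3
  push_cast
  ring

theorem aestronglyMeasurable_matW {p : ℕ} (T : ℝ) (γ : ℤ) (s : Fin p → Signal) (g : Signal)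
    (l m : Fin p) :
    AEStronglyMeasurable (fun ω => matW T γ s g ω l m) (volume.restrict (period T)) := by
  have h : ∀ (x : Signal) (c : ℝ), AEStronglyMeasurable (fun ω => ft x (ω + c))
      (volume.restrict (period T)) := fun x c =>
    ((aestronglyMeasurable_ft x).comp_quasiMeasurePreserving
      (quasiMeasurePreserving_add_right volume c)).restrict
  exact ((Complex.continuous_conj.comp_aestronglyMeasurable (h (s l) _)).const_mul _).mul (h g _)

theorem memLp_top_transfer {K p : ℕ} {T : ℝ} {γ : ℤ} {s : Fin p → Signal} {g : Signal}
    (hW : StablyInvertible T (matW T γ s g)) (t : Fin K → ℝ) (l : Fin p) (k : Fin K) :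
    MemLp (transfer T γ s g t l k) ⊤ (volume.restrict (period T)) := by
  obtain ⟨C, hC⟩ := hW.ae_norm_le
  unfold transfer
  refine memLp_finsetSum _ fun m _ => memLp_top_of_bound ?_ C ?_
  · exact ((aestronglyMeasurable_matW T γ s g l m).mul_const _).mul
      (Continuous.aestronglyMeasurable (by fun_prop))
  · filter_upwards [hC] with ω h
    rw [norm_mul, norm_mul, norm_exp_neg_I_mul, norm_matN, mul_one, mul_one]
    exact h l m

/-- Multiplication by the transfer function on `L²(Ω)`. -/
def transferL {K p : ℕ} {T : ℝ} {γ : ℤ} {s : Fin p → Signal} {g : Signal}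
    (hW : StablyInvertible T (matW T γ s g)) (t : Fin K → ℝ) (l : Fin p) (k : Fin K) :
    Lp ℂ 2 (volume.restrict (period T)) →L[ℂ] Lp ℂ 2 (volume.restrict (period T)) :=
  (ContinuousLinearMap.mul ℂ ℂ).holderL (volume.restrict (period T)) ⊤ 2 2
    ((memLp_top_transfer hW t l k).toLp _)

theorem transferL_ae_eq {K p : ℕ} {T : ℝ} {γ : ℤ} {s : Fin p → Signal} {g : Signal}
    (hW : StablyInvertible T (matW T γ s g)) (t : Fin K → ℝ) (l : Fin p) (k : Fin K)
    (f : Lp ℂ 2 (volume.restrict (period T))) :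
    transferL hW t l k f =ᵐ[volume.restrict (period T)]
      fun ω => transfer T γ s g t l k ω * f ω := by
  have h := (ContinuousLinearMap.mul ℂ ℂ).coeFn_holder (r := 2)
    ((memLp_top_transfer hW t l k).toLp _) f
  filter_upwards [h, (memLp_top_transfer hW t l k).coeFn_toLp] with ω h1 h2
  refine h1.trans ?_
  rw [ContinuousLinearMap.mul_apply', h2]

theorem exp_shift {T : ℝ} (hT : 0 < T) (ω u : ℝ) (M j n : ℤ) :
    Complex.exp (-(Complex.I * ((ω + 2 * Real.pi / T * M : ℝ) : ℂ) *
        (((u + j * T : ℝ) : ℂ) - ((n * T : ℝ) : ℂ)))) =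
      Complex.exp (-(Complex.I * (2 * Real.pi / T) * M * u)) *
        Complex.exp (-(Complex.I * ω * u)) * Complex.exp (-(Complex.I * ω * j * T)) *
        Complex.exp (Complex.I * ω * n * T) := by
  have hT' : (T : ℂ) ≠ 0 := by exact_mod_cast hT.ne'
  rw [← Complex.exp_add, ← Complex.exp_add, ← Complex.exp_add, Complex.exp_eq_exp_iff_exists_int]
  -- The shift `2πM/T` times the delay difference `(j-n)T` is a multiple of `2π`.
  refine ⟨-(M * (j - n)), ?_⟩
  push_cast
  field_simp
  ring

/-- The core computation for a single pulse: Parseval, then folding; periodicity of `e^{-jω(j-n)T}`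
lets it factor out of the sum over translates. -/
theorem inner_delay_eq_inner_expLp {K p : ℕ} {T : ℝ} (hT : 0 < T) {γ : ℤ} {s : Fin p → Signal}
    {g : Signal} (hs : ∀ l, ∀ᵐ ω : ℝ, ω ∉ band T γ p → ft (s l) ω = 0)
    (hW : StablyInvertible T (matW T γ s g)) (t : Fin K → ℝ) (l : Fin p) (k : Fin K) (j n : ℤ) :
    inner ℂ (delay (n * T) (s l)) (delay (t k + j * T) g) =
      ((T / (2 * Real.pi) : ℝ) : ℂ) * inner ℂ (expLp T n) (transferL hW t l k (expLp T j)) := by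
  have hT' : (T : ℂ) ≠ 0 := by exact_mod_cast hT.ne'
  set F : ℝ → ℂ := fun ω => conj (ft (s l) ω) * ft g ω *
    Complex.exp (-(Complex.I * ω * (((t k + j * T : ℝ) : ℂ) - ((n * T : ℝ) : ℂ)))) with hF
  have hFint : Integrable F volume := by
    refine (integrable_ft_mul_ft (s l) g).mul_bdd (c := 1)
      (Continuous.aestronglyMeasurable (by fun_prop)) (Eventually.of_forall fun ω => ?_)
    rw [← Complex.ofReal_sub, norm_exp_neg_I_mul]
  have hF0 : ∀ᵐ ω : ℝ, ω ∉ band T γ p → F ω = 0 := by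
    filter_upwards [hs l] with ω h h1
    simp [hF, h h1]
  -- The factor `T` undoes the `1/T` in `matW` and turns Parseval's `1/(2π)` into `T/(2π)`.
  have hterm : ∀ (m : Fin p) (ω : ℝ), F (ω + 2 * Real.pi / T * ((m : ℕ) + γ)) =
      T * (matW T γ s g ω l m * matN p T γ t m k * Complex.exp (-(Complex.I * ω * t k)) *
        Complex.exp (-(Complex.I * ω * j * T)) * Complex.exp (Complex.I * ω * n * T)) := by
    intro m ω
    have h1 := exp_shift hT ω (t k) ((m : ℕ) + γ) j n
    push_cast at h1
    simp only [hF, matW, matN, Matrix.of_apply]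
    push_cast
    rw [h1]
    field_simp
  rw [inner_delay_delay, integral_eq_sum_integral_period hT γ p hFint hF0,
    ← integral_finsetSum _ fun (m : Fin p) _ => (hFint.comp_add_right _).restrict, inner_expLp]
  have h2 : ∫ ω in period T, ∑ m : Fin p, F (ω + 2 * Real.pi / T * ((m : ℕ) + γ)) =
      ∫ ω in period T, (T : ℂ) *
        (transferL hW t l k (expLp T j) ω * Complex.exp (Complex.I * ω * n * T)) := by
    refine integral_congr_ae ?_
    filter_upwards [transferL_ae_eq hW t l k (expLp T j), expLp_ae_eq T j] with ω h3 h4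
    rw [h3, h4, transfer, Finset.sum_mul, Finset.sum_mul, Finset.mul_sum]
    exact Finset.sum_congr rfl fun m _ => hterm m ω
  rw [h2, integral_const_mul, ← mul_assoc]
  congr 1
  push_cast
  ring

theorem tendsto_sum_Icc_dtft {T : ℝ} (hT : 0 < T) {a : ℤ → ℂ} (ha : Memℓp a 2) :
    Tendsto (fun N : ℕ => ∑ n ∈ Finset.Icc (-(N : ℤ)) N, a n • expLp T n) atTop
      (𝓝 (dtft T a)) := by
  refine (hasSum_dtft hT ha).comp (tendsto_atTop_finset_of_monotone ?_ ?_)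
  · intro M N h
    exact Finset.Icc_subset_Icc (by simpa using h) (by simpa using h)
  · intro n
    exact ⟨n.natAbs, Finset.mem_Icc.2 ⟨by omega, by omega⟩⟩

/-- The samples are the Fourier coefficients of the filtered discrete-time Fourier transforms. -/
theorem sample_eq_inner_expLp {K p : ℕ} {T : ℝ} (hT : 0 < T) {γ : ℤ} {s : Fin p → Signal}
    {g x : Signal} (hs : ∀ l, ∀ᵐ ω : ℝ, ω ∉ band T γ p → ft (s l) ω = 0)
    (hW : StablyInvertible T (matW T γ s g)) {t : Fin K → ℝ} {a : Fin K → ℤ → ℂ}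
    (ha : ∀ k, Memℓp (a k) 2) (hx : IsMultipathSignal T g t a x) (l : Fin p) (n : ℤ) :
    sample T x (s l) n = ((T / (2 * Real.pi) : ℝ) : ℂ) *
      inner ℂ (expLp T n) (∑ k, transferL hW t l k (dtft T (a k))) := by
  rw [sample_eq_inner]
  have h1 := ((innerSL ℂ (delay (n * T) (s l))).continuous.tendsto x).comp hx
  have h2 : Tendsto (fun N : ℕ => ∑ k, transferL hW t l k
      (∑ n ∈ Finset.Icc (-(N : ℤ)) N, a k n • expLp T n)) atTop
      (𝓝 (∑ k, transferL hW t l k (dtft T (a k)))) :=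
    tendsto_finsetSum _ fun k _ =>
      ((transferL hW t l k).continuous.tendsto _).comp (tendsto_sum_Icc_dtft hT (ha k))
  have h3 := (((innerSL ℂ (expLp T n)).continuous.tendsto _).comp h2).const_mul
    ((T / (2 * Real.pi) : ℝ) : ℂ)
  -- The two sequences agree for every `N` by linearity and the single-pulse identity.
  refine tendsto_nhds_unique h1 (h3.congr fun N => ?_)
  simp only [Function.comp_apply, map_sum, map_smul, innerSL_apply_apply, smul_eq_mul,
    inner_delay_eq_inner_expLp hT hs hW, Finset.mul_sum]
  refine Finset.sum_congr rfl fun k _ => Finset.sum_congr rfl fun j _ => ?_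
  ring

theorem memℓp_sample {K p : ℕ} {T : ℝ} (hT : 0 < T) {γ : ℤ} {s : Fin p → Signal}
    {g x : Signal} (hs : ∀ l, ∀ᵐ ω : ℝ, ω ∉ band T γ p → ft (s l) ω = 0)
    (hW : StablyInvertible T (matW T γ s g)) {t : Fin K → ℝ} {a : Fin K → ℤ → ℂ}
    (ha : ∀ k, Memℓp (a k) 2) (hx : IsMultipathSignal T g t a x) (l : Fin p) :
    Memℓp (sample T x (s l)) 2 :=
  (memℓp_and_dtft_eq_of_inner hT (sample_eq_inner_expLp hT hs hW ha hx l)).1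

theorem vecB_apply {K : ℕ} (T : ℝ) (t : Fin K → ℝ) (a : Fin K → ℤ → ℂ) (ω : ℝ) (k : Fin K) :
    vecB T t a ω k = Complex.exp (-(Complex.I * ω * t k)) * dtft T (a k) ω := by
  rw [vecB, matD, Matrix.mulVec_diagonal, dtftVec]

theorem dtftVec_sample_ae_eq {K p : ℕ} {T : ℝ} (hT : 0 < T) {γ : ℤ} {s : Fin p → Signal}
    {g x : Signal} (hs : ∀ l, ∀ᵐ ω : ℝ, ω ∉ band T γ p → ft (s l) ω = 0)
    (hW : StablyInvertible T (matW T γ s g)) {t : Fin K → ℝ} {a : Fin K → ℤ → ℂ}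
    (ha : ∀ k, Memℓp (a k) 2) (hx : IsMultipathSignal T g t a x) :
    ∀ᵐ ω ∂volume.restrict (period T), dtftVec T (fun l => sample T x (s l)) ω =
      matW T γ s g ω *ᵥ (matN p T γ t *ᵥ vecB T t a ω) := by
  have h1 : ∀ l, dtft T (sample T x (s l)) = ∑ k, transferL hW t l k (dtft T (a k)) := fun l =>
    (memℓp_and_dtft_eq_of_inner hT (sample_eq_inner_expLp hT hs hW ha hx l)).2
  have h2 : ∀ᵐ ω ∂volume.restrict (period T), ∀ l,
      (∑ k, transferL hW t l k (dtft T (a k)) : Lp ℂ 2 (volume.restrict (period T))) ω =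
        ∑ k, transferL hW t l k (dtft T (a k)) ω :=
    ae_all_iff.2 fun l => by
      filter_upwards [Lp.coeFn_finsetSum Finset.univ
        fun k => transferL hW t l k (dtft T (a k))] with ω h
      rw [h, Finset.sum_apply]
  have h3 : ∀ᵐ ω ∂volume.restrict (period T), ∀ l k,
      transferL hW t l k (dtft T (a k)) ω = transfer T γ s g t l k ω * dtft T (a k) ω :=
    ae_all_iff.2 fun l => ae_all_iff.2 fun k => transferL_ae_eq hW t l k _
  filter_upwards [h2, h3] with ω h2 h3
  funext l
  rw [dtftVec, h1, h2]
  simp only [h3, transfer, Matrix.mulVec, dotProduct, vecB_apply, Finset.mul_sum, Finset.sum_mul]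
  rw [Finset.sum_comm]
  refine Finset.sum_congr rfl fun m _ => Finset.sum_congr rfl fun k _ => ?_
  ring

theorem vecD_ae_eq {K p : ℕ} {T : ℝ} (hT : 0 < T) {γ : ℤ} {s : Fin p → Signal}
    {g x : Signal} (hs : ∀ l, ∀ᵐ ω : ℝ, ω ∉ band T γ p → ft (s l) ω = 0)
    (hW : StablyInvertible T (matW T γ s g)) {t : Fin K → ℝ} {a : Fin K → ℤ → ℂ}
    (ha : ∀ k, Memℓp (a k) 2) (hx : IsMultipathSignal T g t a x) :
    ∀ᵐ ω ∂volume.restrict (period T),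
      vecD T γ s g x ω = matN p T γ t *ᵥ vecB T t a ω := by
  filter_upwards [dtftVec_sample_ae_eq hT hs hW ha hx, hW.ae_isUnit_det] with ω h1 h2
  rw [vecD, h1, Matrix.mulVec_mulVec, Matrix.nonsing_inv_mul _ h2, Matrix.one_mulVec]

/-- The phases in `𝐃` never vanish, and a nonzero sequence has a nonzero transform. -/
theorem not_ae_vecB_eq_zero {K : ℕ} {T : ℝ} (hT : 0 < T) (t : Fin K → ℝ) {a : Fin K → ℤ → ℂ}
    {k : Fin K} (ha : Memℓp (a k) 2) (h0 : a k ≠ 0) :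
    ¬ ∀ᵐ ω ∂volume.restrict (period T), vecB T t a ω k = 0 := by
  intro h
  refine dtft_ne_zero hT ha h0 (Lp.ext ?_)
  filter_upwards [h, Lp.coeFn_zero ℂ 2 (volume.restrict (period T))] with ω h1 h2
  rw [h2, Pi.zero_apply]
  rw [vecB_apply] at h1
  exact (mul_eq_zero.1 h1).resolve_left (Complex.exp_ne_zero _)

/-! ### Uniqueness up to numbering, and the theorem -/

/-- Two descriptions by `K` paths of the same `p ≥ 2K` measurements agree up to numbering, if no
path of the first vanishes. -/
theorem exists_perm_of_ae_matN_mulVec_eq {K p : ℕ} {T : ℝ} (hT : 0 < T) (γ : ℤ) {μ : Measure ℝ}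
    {t t' : Fin K → ℝ} (ht : ∀ k, t k ∈ Set.Ico 0 T) (ht_inj : Function.Injective t)
    (ht' : ∀ k, t' k ∈ Set.Ico 0 T) (ht'_inj : Function.Injective t') (hp : 2 * K ≤ p)
    {b b' : ℝ → Fin K → ℂ} (hb : ∀ k, ¬ ∀ᵐ ω ∂μ, b ω k = 0)
    (h : ∀ᵐ ω ∂μ, matN p T γ t *ᵥ b ω = matN p T γ t' *ᵥ b' ω) :
    ∃ σ : Equiv.Perm (Fin K), (∀ k, t' k = t (σ k)) ∧ ∀ᵐ ω ∂μ, ∀ k, b' ω k = b ω (σ k) := by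
  have hsum : ∀ {q : Fin K → ℝ}, Function.Injective q → ∀ (c : Fin K → ℂ) (k : Fin K),
      ∑ i, (if q i = q k then c i else 0) = c k := by
    intro q hq c k
    simp [hq.eq_iff]
  have hex : ∀ k, ∃ i, t' i = t k := by
    intro k
    by_contra! hk
    refine hb k ?_
    filter_upwards [h] with ω hω
    have h1 := sum_ite_eq_of_matN_mulVec_eq hT γ ht ht' hp hω (t k)
    rw [hsum ht_inj] at h1
    simpa [hk] using h1
  -- `τ k` is the index at which `t'` takes the value `t k`; being injective on `Fin K` it is a
  -- permutation, and its inverse is the required `σ`.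
  choose τ hτ using hex
  have hτ_inj : Function.Injective τ := fun i j hij => ht_inj (by rw [← hτ, ← hτ, hij])
  let e : Equiv.Perm (Fin K) := Equiv.ofBijective τ (Finite.injective_iff_bijective.1 hτ_inj)
  have he : ∀ k, t' k = t (e.symm k) := by
    intro k
    rw [← hτ]
    exact congrArg t' (e.apply_symm_apply k).symm
  refine ⟨e.symm, he, ?_⟩
  filter_upwards [h] with ω hω k
  have h1 := sum_ite_eq_of_matN_mulVec_eq hT γ ht ht' hp hω (t' k)
  rw [hsum ht'_inj] at h1
  rw [← h1, he k, hsum ht_inj]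

end

end TimeDelay

theorem proposition1 {K p : ℕ} (T : ℝ) (hT : 0 < T) (γ : ℤ)
    (g : Signal) (t : Fin K → ℝ) (ht : ∀ k, t k ∈ Set.Ico 0 T) (ht_inj : Function.Injective t)
    (a : Fin K → ℤ → ℂ) (ha : ∀ k, Memℓp (a k) 2)
    (x : Signal) (hx : IsMultipathSignal T g t a x)
    (s : Fin p → Signal)
    (hs : ∀ l, ∀ᵐ ω : ℝ, ω ∉ band T γ p → ft (s l) ω = 0)
    (hG : ∃ α β : ℝ, 0 < α ∧
      ∀ᵐ ω ∂volume.restrict (band T γ p), α ≤ ‖ft g ω‖ ∧ ‖ft g ω‖ ≤ β)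
    (hS : StablyInvertible T (matS T γ s)) :
    -- the sample sequences have discrete-time Fourier transforms, and `𝐖⁻¹` is a stable filter
    (∀ l, Memℓp (sample T x (s l)) 2) ∧
    StablyInvertible T (matW T γ s g) ∧
    -- `𝐝 = 𝐍(τ) 𝐛`
    (∀ᵐ ω ∂volume.restrict (period T),
      vecD T γ s g x ω = matN p T γ t *ᵥ vecB T t a ω) ∧
    -- these equations determine the delays and `𝐛` up to the numbering of the paths
    (2 * K ≤ p → (∀ k, a k ≠ 0) →
      ∀ (t' : Fin K → ℝ) (b' : ℝ → Fin K → ℂ),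
        (∀ k, t' k ∈ Set.Ico 0 T) → Function.Injective t' →
        (∀ᵐ ω ∂volume.restrict (period T), vecD T γ s g x ω = matN p T γ t' *ᵥ b' ω) →
        ∃ σ : Equiv.Perm (Fin K), (∀ k, t' k = t (σ k)) ∧
          ∀ᵐ ω ∂volume.restrict (period T), ∀ k, b' ω k = vecB T t a ω (σ k)) ∧
    -- `𝐚 = 𝐃⁻¹ 𝐍† 𝐝`
    (K ≤ p → ∀ᵐ ω ∂volume.restrict (period T),
      dtftVec T a ω = (matD t ω)⁻¹ *ᵥ (pinv (matN p T γ t) *ᵥ vecD T γ s g x ω)) := by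
  have hW := stablyInvertible_matW hT hG hS
  have hD := vecD_ae_eq hT hs hW ha hx
  refine ⟨memℓp_sample hT hs hW ha hx, hW, hD, ?_, ?_⟩
  · intro hp h0 t' b' ht' ht'_inj h
    refine exists_perm_of_ae_matN_mulVec_eq hT γ ht ht_inj ht' ht'_inj hp
      (fun k => not_ae_vecB_eq_zero hT t (ha k) (h0 k)) ?_
    filter_upwards [hD, h] with ω h1 h2
    rw [← h1, h2]
  · intro hp
    filter_upwards [hD] with ω h1
    rw [h1, Matrix.mulVec_mulVec (vecB T t a ω),
      pinv_mul_self_of_injective (matN_mulVec_injective hT γ ht ht_inj hp), Matrix.one_mulVec, vecB,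
      Matrix.mulVec_mulVec, Matrix.nonsing_inv_mul _ (isUnit_det_matD t ω), Matrix.one_mulVec]
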